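/- Let $X=(\Omega,\mathcal F,P)$ be a probability space, let $E$ be a finite set with $|E|=n$, and let $X^E=(\Omega^E,\mathcal F^E,\mathbb P=P^E)$ be the product space. For an event $A\in\mathcal F^E$, an index $e\in E$ and $\psi\in\Omega^{E\setminus\{e\}}$, let $A_{e,\psi}\subseteq\Omega$ be the set of all $x\in\Omega$ such that the configuration equal to $x$ at $e$ and to $\psi$ off $e$ belongs to $A$. The influence of $e$ on $A$ is $$I_A(e)=P^{E\setminus\{e\}}\bigl(\{\psi\in\Omega^{E\setminus\{e\}}: 0<P(A_{e,\psi})<1\}\bigr).$$ There exist absolute constants $c,c'\in(0,\infty)$ (not depending on $X$, $E$ or $A$) such that, for every probability space $X$, every finite set $E$ with $|E|=n$ and every event $A\in\mathcal F^E$ with $0<\mathbb P(A)<1$, the maximum $m=\max_{e\in E}I_A(e)$ is strictly positive, $$\sum_{e\in E} I_A(e)\ \ge\ c\,\mathbb P(A)\,(1-\mathbb P(A))\,\log\frac{1}{2m},$$ and there exists $e\in E$ with $$I_A(e)\ \ge\ c'\,\mathbb P(A)\,(1-\mathbb P(A))\,\frac{\log n}{n}.$$ -/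

import Mathlib

/-- The configuration on `E` that takes the value `x` at `e` and agrees with `ψ` off `e`. -/
def extendAt {Ω E : Type*} [DecidableEq E] (e : E) (ψ : {f : E // f ≠ e} → Ω) (x : Ω) : E → Ω :=
  fun f => if h : f = e then x else ψ ⟨f, h⟩

/-- The part of `A` lying in the fibre `F_ψ = {ψ} × Ω`, as a subset of `Ω`. -/
def fibreSection {Ω E : Type*} [DecidableEq E] (A : Set (E → Ω)) (e : E)
    (ψ : {f : E // f ≠ e} → Ω) : Set Ω :=
  {x | extendAt e ψ x ∈ A}

/-- The influence of `e` on `A`: the probability, over the coordinates other than `e`, that the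
conditional probability of `A` on the fibre in direction `e` lies strictly between `0` and `1`. -/
noncomputable def influence {Ω E : Type*} [MeasurableSpace Ω] (P : MeasureTheory.Measure Ω)
    [Fintype E] [DecidableEq E] (A : Set (E → Ω)) (e : E) : ℝ :=
  (MeasureTheory.Measure.pi (fun _ : {f : E // f ≠ e} => P)).real
    {ψ | 0 < P (fibreSection A e ψ) ∧ P (fibreSection A e ψ) < 1}

/-! The proof reduces an arbitrary product space to a finite grid, the grid to the discrete cube,
and applies entropy methods there.

On the cube, let `K > 0`. Revealing bits one at a time splits the variance into second moments of
half-derivatives. Each such moment is bounded by an entropy plus an `L¹` term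
(`moment_le_uniformEnt`), and the entropy is bounded by the energy through the logarithmic Sobolev
inequality (`uniformEnt_sq_le_cubeEnergy`). Summing gives `variance_mul_le_cubeEnergy`. For an
indicator, energy and `L¹` influences coincide, and `K = √δ` yields the Kahn–Kalai–Linial bound.

On a grid of side `2 ^ k`, compression makes the set a lower set without enlarging any line boundary
(`exists_lowerAlong`). Coordinates are then written in binary. A lower set meets each line in an
initial segment, so the bit of weight `2 ^ j` matters only near the endpoint. These influences sum
geometrically, and one coordinate costs a factor 2 however large `k` is.

For general `Ω`, draw `2 ^ k` independent samples per coordinate. With `k` large, the induced random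
subset of the grid has nearly the right density, and its line boundaries have density at most about
the influences (`exists_grid_approximation`). Zero-one fibres look constant almost surely, which is
why this definition of influence survives sampling. -/

open scoped BigOperators

/-! ### Entropy and influences on the discrete cube. -/

section Cube

/-- Splitting a mean over the cube according to the first bit. -/
theorem cube_expect_succ {N : ℕ} (f : (Fin (N + 1) → Fin 2) → ℝ) :
    𝔼 x, f x = (𝔼 x, f (Fin.cons 0 x) + 𝔼 x, f (Fin.cons 1 x)) / 2 := by
  have h : ∑ x, f x = ∑ x, f (Fin.cons 0 x) + ∑ x, f (Fin.cons 1 x) := by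
    rw [← (Fin.consEquiv (fun _ : Fin (N + 1) => Fin 2)).sum_comp, Fintype.sum_prod_type,
      Fin.sum_univ_two]
    rfl
  simp only [Fintype.expect_eq_sum_div_card, h, Fintype.card_pi, Finset.prod_const,
    Fintype.card_fin, Finset.card_univ]
  push_cast
  field_simp
  ring

/-- The discrete derivative in the direction `i`. -/
def bitDeriv {B : Type*} [DecidableEq B] (f : (B → Fin 2) → ℝ) (i : B) (x : B → Fin 2) : ℝ :=
  f (Function.update x i 1) - f (Function.update x i 0)

/-- The Dirichlet energy on the cube. -/
noncomputable def cubeEnergy {B : Type*} [Fintype B] [DecidableEq B]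
    (f : (B → Fin 2) → ℝ) : ℝ :=
  ∑ i, 𝔼 x, bitDeriv f i x ^ 2

/-- The entropy of a nonnegative function on a finite set with its uniform measure. -/
noncomputable def uniformEnt {X : Type*} [Fintype X] (f : X → ℝ) : ℝ :=
  𝔼 x, f x * Real.log (f x) - (𝔼 x, f x) * Real.log (𝔼 x, f x)

theorem bitDeriv_cons_zero {N : ℕ} (f : (Fin (N + 1) → Fin 2) → ℝ) (b : Fin 2)
    (x : Fin N → Fin 2) :
    bitDeriv f 0 (Fin.cons b x) = f (Fin.cons 1 x) - f (Fin.cons 0 x) := by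
  simp [bitDeriv]

theorem bitDeriv_cons_succ {N : ℕ} (f : (Fin (N + 1) → Fin 2) → ℝ) (b : Fin 2) (i : Fin N)
    (x : Fin N → Fin 2) :
    bitDeriv f i.succ (Fin.cons b x) = bitDeriv (fun y => f (Fin.cons b y)) i x := by
  simp [bitDeriv, Fin.cons_update]

theorem cubeEnergy_succ {N : ℕ} (f : (Fin (N + 1) → Fin 2) → ℝ) :
    cubeEnergy f = 𝔼 x : Fin N → Fin 2, (f (Fin.cons 1 x) - f (Fin.cons 0 x)) ^ 2
      + (cubeEnergy (fun y => f (Fin.cons 0 y)) + cubeEnergy (fun y => f (Fin.cons 1 y))) / 2 := by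
  simp only [cubeEnergy, Fin.sum_univ_succ, cube_expect_succ, bitDeriv_cons_zero,
    bitDeriv_cons_succ, ← Finset.sum_add_distrib, ← Finset.sum_div]
  ring

/-- This is the one-bit logarithmic Sobolev inequality. Linearising `log` at the mean bounds the
entropy by variance over mean; this loses a constant factor, which is harmless here. -/
theorem mul_log_two_point_le {a b : ℝ} (ha : 0 ≤ a) (hb : 0 ≤ b) :
    (a ^ 2 * Real.log (a ^ 2) + b ^ 2 * Real.log (b ^ 2)) / 2
      - (a ^ 2 + b ^ 2) / 2 * Real.log ((a ^ 2 + b ^ 2) / 2) ≤ (b - a) ^ 2 := by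
  set m := (a ^ 2 + b ^ 2) / 2 with hm
  rcases eq_or_lt_of_le (show 0 ≤ m by positivity) with h0 | h0
  · have ha0 : a = 0 := by nlinarith
    have hb0 : b = 0 := by nlinarith
    simp [← h0, ha0, hb0]
  have key : ∀ s : ℝ, 0 ≤ s → s * Real.log s ≤ s * Real.log m + s * (s / m - 1) := by
    intro s hs
    rcases eq_or_lt_of_le hs with rfl | hs
    · simp
    have := Real.log_le_sub_one_of_pos (div_pos hs h0)
    rw [Real.log_div hs.ne' h0.ne'] at this
    nlinarith
  have h1 := key (a ^ 2) (by positivity)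
  have h2 := key (b ^ 2) (by positivity)
  have h3 : (a ^ 2 * (a ^ 2 / m - 1) + b ^ 2 * (b ^ 2 / m - 1)) / 2 ≤ (b - a) ^ 2 := by
    have : (a ^ 2 * (a ^ 2 / m - 1) + b ^ 2 * (b ^ 2 / m - 1)) / 2
        = ((a ^ 2 - b ^ 2) / 2) ^ 2 / m := by
      field_simp
      rw [hm]
      ring
    -- After factoring out `(b - a) ^ 2`, what remains is `(a + b) ^ 2 ≤ 2 * (a ^ 2 + b ^ 2)`.
    rw [this, div_le_iff₀ h0, hm]
    nlinarith [sq_nonneg ((b - a) * (b - a)), mul_nonneg ha hb, sq_nonneg (b - a),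
      mul_nonneg (sq_nonneg (b - a)) (sq_nonneg (b - a))]
  have h4 : m * Real.log m = (a ^ 2 * Real.log m + b ^ 2 * Real.log m) / 2 := by
    rw [← add_mul, mul_div_right_comm, ← hm]
  linarith

/-- The reverse triangle inequality in `L²`. It turns the two-point inequality, applied to the norms
of the two halves of the cube, into a bound by the derivative in the first bit. -/
theorem sq_sub_sqrt_expect_sq_le {X : Type*} [Fintype X] (f g : X → ℝ) :
    (√(𝔼 x, f x ^ 2) - √(𝔼 x, g x ^ 2)) ^ 2 ≤ 𝔼 x, (f x - g x) ^ 2 := by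
  have hf : 0 ≤ 𝔼 x, f x ^ 2 := Finset.expect_nonneg fun _ _ => sq_nonneg _
  have hg : 0 ≤ 𝔼 x, g x ^ 2 := Finset.expect_nonneg fun _ _ => sq_nonneg _
  have hcs : (𝔼 x, f x * g x) ^ 2 ≤ (𝔼 x, f x ^ 2) * 𝔼 x, g x ^ 2 := by
    simp only [Fintype.expect_eq_sum_div_card]
    rw [div_pow, div_mul_div_comm, ← sq]
    gcongr
    exact Finset.sum_mul_sq_le_sq_mul_sq _ _ _
  have h1 : 𝔼 x, f x * g x ≤ √(𝔼 x, f x ^ 2) * √(𝔼 x, g x ^ 2) := by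
    rw [← Real.sqrt_mul hf]
    exact Real.le_sqrt_of_sq_le hcs
  have h2 : 𝔼 x, (f x - g x) ^ 2 = 𝔼 x, f x ^ 2 + 𝔼 x, g x ^ 2 - 2 * 𝔼 x, f x * g x := by
    rw [Finset.mul_expect, ← Finset.expect_add_distrib, ← Finset.expect_sub_distrib]
    exact Finset.expect_congr rfl fun x _ => by ring
  rw [h2, sub_sq, Real.sq_sqrt hf, Real.sq_sqrt hg]
  linarith

/-- The logarithmic Sobolev inequality on the cube. -/
theorem uniformEnt_sq_le_cubeEnergy : ∀ {N : ℕ} (f : (Fin N → Fin 2) → ℝ),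
    uniformEnt (fun x => f x ^ 2) ≤ cubeEnergy f
  | 0, f => by
    simp [uniformEnt, cubeEnergy]
  | N + 1, f => by
    have h0 := uniformEnt_sq_le_cubeEnergy (fun y => f (Fin.cons 0 y))
    have h1 := uniformEnt_sq_le_cubeEnergy (fun y => f (Fin.cons 1 y))
    have h2 := sq_sub_sqrt_expect_sq_le (fun y : Fin N → Fin 2 => f (Fin.cons 1 y))
      (fun y => f (Fin.cons 0 y))
    have h3 := mul_log_two_point_le (Real.sqrt_nonneg (𝔼 y : Fin N → Fin 2, f (Fin.cons 0 y) ^ 2))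
      (Real.sqrt_nonneg (𝔼 y : Fin N → Fin 2, f (Fin.cons 1 y) ^ 2))
    rw [Real.sq_sqrt (Finset.expect_nonneg fun _ _ => sq_nonneg _),
      Real.sq_sqrt (Finset.expect_nonneg fun _ _ => sq_nonneg _)] at h3
    rw [cubeEnergy_succ]
    -- Chain rule: the entropy is the mean of the entropies of the two halves plus the two-point
    -- entropy of their means.
    simp only [uniformEnt] at h0 h1 ⊢
    rw [cube_expect_succ, cube_expect_succ]
    linarith

/-- A lower bound for the entropy of a square in terms of first and second moments. -/
theorem moment_le_uniformEnt {X : Type*} [Fintype X] (h : X → ℝ) {K : ℝ} (hK : 0 < K) :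
    (𝔼 x, h x ^ 2) * (1 - Real.log K) ≤
      uniformEnt (fun x => h x ^ 2) + (𝔼 x, |h x|) ^ 2 / K := by
  set v := 𝔼 x, h x ^ 2 with hv
  set a := 𝔼 x, |h x| with ha
  have ha0 : 0 ≤ a := Finset.expect_nonneg fun _ _ => abs_nonneg _
  have hv0 : 0 ≤ v := Finset.expect_nonneg fun _ _ => sq_nonneg _
  rcases eq_or_lt_of_le ha0 with h0 | h0
  · have hz : ∀ x, h x = 0 := by
      intro x
      have := (Finset.expect_eq_zero_iff_of_nonneg
        (fun i _ => abs_nonneg (h i))).1 (ha.symm.trans h0.symm) x (Finset.mem_univ x)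
      simpa using this
    simp [hv, ha, uniformEnt, hz]
  have hvpos : 0 < v := by
    rcases eq_or_lt_of_le hv0 with h1 | h1
    · exfalso
      have hz : ∀ x, h x = 0 := by
        intro x
        have := (Finset.expect_eq_zero_iff_of_nonneg
          (fun i _ => sq_nonneg (h i))).1 (hv.symm.trans h1.symm) x (Finset.mem_univ x)
        simpa using this
      simp [ha, hz] at h0
    · exact h1
  -- From `log t ≤ t - 1` at `t = v / (a * |h x|)`. After averaging, the linear terms cancel, so the
  -- entropy is at least `v * log (v / a ^ 2)`.
  have key : ∀ x, h x ^ 2 * (2 * Real.log (v / a) + 2) - 2 * (v / a) * |h x|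
      ≤ h x ^ 2 * Real.log (h x ^ 2) := by
    intro x
    rcases eq_or_ne (h x) 0 with hx | hx
    · simp [hx]
    have hx' : 0 < |h x| := abs_pos.2 hx
    have h1 := Real.log_le_sub_one_of_pos (div_pos (div_pos hvpos h0) hx')
    rw [Real.log_div (div_pos hvpos h0).ne' hx'.ne'] at h1
    have h2 : Real.log (h x ^ 2) = 2 * Real.log |h x| := by
      rw [← sq_abs, Real.log_pow]; norm_num
    have h3 : h x ^ 2 * (v / a / |h x|) = v / a * |h x| := by
      rw [← sq_abs]; field_simp
    have h4 := mul_le_mul_of_nonneg_left h1 (sq_nonneg (h x))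
    rw [h2]
    nlinarith
  have hsum : v * (2 * Real.log (v / a)) ≤ 𝔼 x, h x ^ 2 * Real.log (h x ^ 2) := by
    have := Finset.expect_le_expect (s := Finset.univ) fun x _ => key x
    rw [Finset.expect_sub_distrib, ← Finset.expect_mul, ← Finset.mul_expect, ← hv, ← ha] at this
    have e : 2 * (v / a) * a = 2 * v := by field_simp
    linarith
  -- A second tangent line, placed at `a ^ 2 = v * K`, replaces `log (v / a ^ 2)` by an expression
  -- linear in `a ^ 2`.
  have hlog := Real.log_le_sub_one_of_pos (show 0 < a ^ 2 / (v * K) by positivity)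
  rw [Real.log_div (by positivity) (by positivity), Real.log_mul hvpos.ne' hK.ne',
    Real.log_pow] at hlog
  have hlog2 := mul_le_mul_of_nonneg_left hlog hv0
  have e2 : v * (a ^ 2 / (v * K)) = a ^ 2 / K := by field_simp
  rw [Real.log_div hvpos.ne' h0.ne'] at hsum
  simp only [uniformEnt, ← hv]
  push_cast at hlog2
  nlinarith

/-- The Falik–Samorodnitsky inequality on the cube. -/
theorem variance_mul_le_cubeEnergy {K : ℝ} (hK : 0 < K) : ∀ {N : ℕ} (f : (Fin N → Fin 2) → ℝ),
    (𝔼 x, f x ^ 2 - (𝔼 x, f x) ^ 2) * (1 - Real.log K) ≤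
      cubeEnergy f + (∑ i, (𝔼 x, |bitDeriv f i x|) ^ 2) / K
  | 0, f => by
    simp [cubeEnergy]
  | N + 1, f => by
    set f0 : (Fin N → Fin 2) → ℝ := fun y => f (Fin.cons 0 y) with hf0
    set f1 : (Fin N → Fin 2) → ℝ := fun y => f (Fin.cons 1 y) with hf1
    -- The mean `g` and half-difference `h` in the first bit are orthogonal components. Variance and
    -- energy split along them; induction handles `g`, and log-Sobolev handles `h`.
    set g : (Fin N → Fin 2) → ℝ := fun y => (f0 y + f1 y) / 2 with hg
    set h : (Fin N → Fin 2) → ℝ := fun y => (f1 y - f0 y) / 2 with hh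
    have ih := variance_mul_le_cubeEnergy hK g
    have hent := (moment_le_uniformEnt h hK).trans
      (add_le_add_left (uniformEnt_sq_le_cubeEnergy h) _)
    have hvar : 𝔼 x, f x ^ 2 - (𝔼 x, f x) ^ 2
        = (𝔼 x, g x ^ 2 - (𝔼 x, g x) ^ 2) + 𝔼 x, h x ^ 2 := by
      have e1 : 𝔼 x, g x ^ 2 + 𝔼 x, h x ^ 2 = (𝔼 x, f0 x ^ 2 + 𝔼 x, f1 x ^ 2) / 2 := by
        rw [← Finset.expect_add_distrib, ← Finset.expect_add_distrib, Finset.expect_div]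
        exact Finset.expect_congr rfl fun x _ => by simp only [hg, hh]; ring
      have e2 : 𝔼 x, g x = (𝔼 x, f0 x + 𝔼 x, f1 x) / 2 := by
        rw [← Finset.expect_add_distrib, Finset.expect_div]
      rw [cube_expect_succ, cube_expect_succ f, e2]
      linarith
    have hen : cubeEnergy f = 𝔼 x, (f1 x - f0 x) ^ 2 + cubeEnergy g + cubeEnergy h := by
      rw [cubeEnergy_succ, add_assoc]
      congr 1
      simp only [cubeEnergy, ← Finset.sum_add_distrib, Finset.sum_div]
      refine Finset.sum_congr rfl fun i _ => ?_
      rw [← Finset.expect_add_distrib, ← Finset.expect_add_distrib, Finset.expect_div]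
      exact Finset.expect_congr rfl fun x _ => by simp only [bitDeriv, hg, hh, hf0, hf1]; ring
    have hsq : (𝔼 x, |h x|) ^ 2 ≤ (𝔼 x, |bitDeriv f 0 x|) ^ 2 := by
      have : 𝔼 x, |bitDeriv f 0 x| = 2 * 𝔼 x, |h x| := by
        rw [cube_expect_succ]
        simp only [bitDeriv_cons_zero, Finset.mul_expect, hh, abs_div, abs_two]
        rw [add_self_div_two]
        exact Finset.expect_congr rfl fun x _ => by ring
      have h0 : 0 ≤ 𝔼 x, |h x| := Finset.expect_nonneg fun _ _ => abs_nonneg _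
      rw [this]
      nlinarith
    have hsum : ∑ i, (𝔼 x, |bitDeriv g i x|) ^ 2
        ≤ ∑ i : Fin N, (𝔼 x, |bitDeriv f i.succ x|) ^ 2 := by
      refine Finset.sum_le_sum fun i _ => ?_
      have h0 : 0 ≤ 𝔼 x, |bitDeriv g i x| := Finset.expect_nonneg fun _ _ => abs_nonneg _
      refine pow_le_pow_left₀ h0 ?_ 2
      rw [cube_expect_succ, ← Finset.expect_add_distrib, Finset.expect_div]
      refine Finset.expect_le_expect fun x _ => ?_
      simp only [bitDeriv_cons_succ]
      have : bitDeriv g i x = (bitDeriv f0 i x + bitDeriv f1 i x) / 2 := by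
        simp only [bitDeriv, hg]; ring
      rw [this, abs_div, abs_two]
      gcongr
      exact abs_add_le _ _
    have hnn : 0 ≤ 𝔼 x, (f1 x - f0 x) ^ 2 := Finset.expect_nonneg fun _ _ => sq_nonneg _
    rw [hvar, hen, Fin.sum_univ_succ, add_mul, add_div]
    have d1 := div_le_div_of_nonneg_right hsq hK.le
    have d2 := div_le_div_of_nonneg_right hsum hK.le
    linarith

/-- The Kahn–Kalai–Linial inequality on the cube. -/
theorem variance_mul_log_le_sum_influence_fin {N : ℕ} (f : (Fin N → Fin 2) → ℝ)
    (hf : ∀ x, f x = 0 ∨ f x = 1) {δ : ℝ} (hδ : 0 < δ) (hδ1 : δ ≤ 1)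
    (h : ∀ i, 𝔼 x, |bitDeriv f i x| ≤ δ) :
    (𝔼 x, f x) * (1 - 𝔼 x, f x) * Real.log (1 / δ) ≤ 4 * ∑ i, 𝔼 x, |bitDeriv f i x| := by
  -- With `K = √δ` the `L¹` term is at most `√δ * W ≤ W`, while the factor on the left is `1 + log
  -- (1 / δ) / 2`. Hence the constant 4.
  have hs : 0 < √δ := Real.sqrt_pos.2 hδ
  have hs1 : √δ ≤ 1 := Real.sqrt_le_one.2 hδ1
  have key := variance_mul_le_cubeEnergy hs f
  have e1 : 𝔼 x, f x ^ 2 = 𝔼 x, f x :=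
    Finset.expect_congr rfl fun x _ => by rcases hf x with h | h <;> simp [h]
  have e2 : cubeEnergy f = ∑ i, 𝔼 x, |bitDeriv f i x| := by
    refine Finset.sum_congr rfl fun i _ => Finset.expect_congr rfl fun x _ => ?_
    rw [bitDeriv]
    rcases hf (Function.update x i 1) with h | h <;> rcases hf (Function.update x i 0) with h' | h'
      <;> simp [h, h']
  set W := ∑ i, 𝔼 x, |bitDeriv f i x| with hW
  have hW0 : 0 ≤ W := Finset.sum_nonneg fun i _ => Finset.expect_nonneg fun _ _ => abs_nonneg _
  have h3 : ∑ i, (𝔼 x, |bitDeriv f i x|) ^ 2 ≤ δ * W := by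
    rw [hW, Finset.mul_sum]
    refine Finset.sum_le_sum fun i _ => ?_
    rw [sq]
    exact mul_le_mul_of_nonneg_right (h i) (Finset.expect_nonneg fun _ _ => abs_nonneg _)
  have h4 : (∑ i, (𝔼 x, |bitDeriv f i x|) ^ 2) / √δ ≤ W := by
    rw [div_le_iff₀ hs]
    have : δ = √δ * √δ := (Real.mul_self_sqrt hδ.le).symm
    nlinarith [mul_nonneg hW0 hs.le]
  have hp0 : 0 ≤ 𝔼 x, f x := Finset.expect_nonneg fun x _ => by rcases hf x with h | h <;> simp [h]
  have hp1 : 𝔼 x, f x ≤ 1 :=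
    Finset.expect_le Finset.univ_nonempty fun x _ => by rcases hf x with h | h <;> simp [h]
  rw [Real.log_sqrt hδ.le, e1, e2] at key
  rw [one_div, Real.log_inv]
  nlinarith [mul_nonneg hp0 (sub_nonneg.2 hp1)]

theorem variance_mul_log_le_sum_influence {B : Type*} [Fintype B] [DecidableEq B]
    (f : (B → Fin 2) → ℝ) (hf : ∀ x, f x = 0 ∨ f x = 1) {δ : ℝ} (hδ : 0 < δ) (hδ1 : δ ≤ 1)
    (h : ∀ i, 𝔼 x, |bitDeriv f i x| ≤ δ) :
    (𝔼 x, f x) * (1 - 𝔼 x, f x) * Real.log (1 / δ) ≤ 4 * ∑ i, 𝔼 x, |bitDeriv f i x| := by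
  let σ := Fintype.equivFin B
  let τ : (Fin (Fintype.card B) → Fin 2) ≃ (B → Fin 2) := σ.symm.arrowCongr (Equiv.refl _)
  have hτ : ∀ x b, τ x b = x (σ b) := fun x b => rfl
  have hu : ∀ x i b, τ (Function.update x (σ i) b) = Function.update (τ x) i b := by
    intro x i b
    ext1 j
    by_cases hj : j = i
    · subst hj; simp [hτ]
    · simp [hτ, hj]
  have hd : ∀ i, 𝔼 x, |bitDeriv (fun x => f (τ x)) (σ i) x| = 𝔼 x, |bitDeriv f i x| := by
    intro i
    refine Fintype.expect_equiv τ _ _ fun x => ?_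
    simp only [bitDeriv, hu]
  have hm : 𝔼 x, f (τ x) = 𝔼 x, f x := Fintype.expect_equiv τ _ _ fun x => rfl
  have key := variance_mul_log_le_sum_influence_fin (fun x => f (τ x)) (fun x => hf _) hδ hδ1
    (fun i => by
      obtain ⟨j, rfl⟩ := σ.surjective i
      rw [hd]
      exact h j)
  rw [hm, ← σ.sum_comp] at key
  simpa only [hd] using key

end Cube

/-! ### Compression of subsets of a finite grid. -/

section Grid

variable {E T : Type*}

/-- The density of a subset of a finite type. -/
noncomputable def uniformDensity {X : Type*} [Fintype X] (A : Set X) : ℝ :=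
  𝔼 x, A.indicator (fun _ => (1 : ℝ)) x

theorem uniformDensity_eq_card_div {X : Type*} [Fintype X] (A : Set X) [DecidablePred (· ∈ A)] :
    uniformDensity A = (Finset.univ.filter (· ∈ A)).card / Fintype.card X := by
  rw [uniformDensity, Fintype.expect_eq_sum_div_card]
  simp [Set.indicator_apply]

theorem uniformDensity_mono {X : Type*} [Fintype X] {A B : Set X} (h : A ⊆ B) :
    uniformDensity A ≤ uniformDensity B :=
  Finset.expect_le_expect fun x _ =>
    Set.indicator_le_indicator_of_subset h (fun _ => zero_le_one) x

theorem uniformDensity_nonneg {X : Type*} [Fintype X] (A : Set X) : 0 ≤ uniformDensity A :=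
  Finset.expect_nonneg fun _ _ => Set.indicator_nonneg (fun _ _ => zero_le_one) _

/-- Resampling one coordinate does not change a mean over a finite product. -/
theorem expect_expect_update [Fintype E] [DecidableEq E] [Fintype T] [Nonempty T]
    (e : E) (g : (E → T) → ℝ) :
    𝔼 t, 𝔼 i, g (Function.update t e i) = 𝔼 t, g t := by
  -- Swapping the fresh value with the old coordinate permutes all pairs.
  have hinv : Function.Involutive
      (fun p : T × (E → T) => (p.2 e, Function.update p.2 e p.1)) := by
    rintro ⟨i, t⟩
    simp
  have h1 : ∑ i : T, ∑ t : E → T, g (Function.update t e i) = ∑ _i : T, ∑ t : E → T, g t := by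
    rw [← Fintype.sum_prod_type', ← Fintype.sum_prod_type']
    exact Fintype.sum_equiv hinv.toPerm _ _ fun p => rfl
  have h2 : 𝔼 t, 𝔼 i, g (Function.update t e i) = 𝔼 i : T, 𝔼 t, g (Function.update t e i) :=
    Finset.expect_comm _ _ _
  rw [h2]
  simp only [Fintype.expect_eq_sum_div_card, ← Finset.sum_div, h1]
  have : (Fintype.card T : ℝ) ≠ 0 := by exact_mod_cast Fintype.card_ne_zero
  simp only [Finset.sum_const, Finset.card_univ, nsmul_eq_mul]
  field_simp

theorem uniformDensity_eq_expect_line [Fintype E] [DecidableEq E] [Fintype T] [Nonempty T]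
    (e : E) (A : Set (E → T)) :
    uniformDensity A = 𝔼 t, uniformDensity {i | Function.update t e i ∈ A} := by
  rw [uniformDensity, ← expect_expect_update e]
  rfl

/-- The points whose line in the direction `e` meets both `A` and its complement. -/
def lineBoundary [DecidableEq E] (A : Set (E → T)) (e : E) : Set (E → T) :=
  {t | (∃ i, Function.update t e i ∈ A) ∧ ∃ i, Function.update t e i ∉ A}

/-- `A` is a lower set along every line in the direction `e`. -/
def LowerAlong [DecidableEq E] [LE T] (A : Set (E → T)) (e : E) : Prop :=
  ∀ t i j, i ≤ j → Function.update t e j ∈ A → Function.update t e i ∈ A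

open Classical in
/-- The number of points of `A` on the line through `t` in the direction `e`. -/
noncomputable def lineCount [DecidableEq E] [Fintype T] (A : Set (E → T)) (e : E) (t : E → T) : ℕ :=
  (Finset.univ.filter fun i => Function.update t e i ∈ A).card

theorem lineCount_update [DecidableEq E] [Fintype T] (A : Set (E → T)) (e : E) (t : E → T)
    (i : T) : lineCount A e (Function.update t e i) = lineCount A e t := by
  classical
  exact congrArg Finset.card (Finset.filter_congr fun _ _ => by rw [Function.update_idem])

/-- Push `A` down to an initial segment along each line in the direction `e`. -/
def compress [DecidableEq E] {N : ℕ} (A : Set (E → Fin N)) (e : E) : Set (E → Fin N) :=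
  {t | (t e : ℕ) < lineCount A e t}

theorem update_mem_compress [DecidableEq E] {N : ℕ} {A : Set (E → Fin N)} {e : E}
    {t : E → Fin N} {i : Fin N} :
    Function.update t e i ∈ compress A e ↔ (i : ℕ) < lineCount A e t := by
  simp [compress, lineCount_update]

theorem update_update_mem_compress [DecidableEq E] {N : ℕ} {A : Set (E → Fin N)} {e f : E}
    (hef : f ≠ e) {t : E → Fin N} {i j : Fin N} :
    Function.update (Function.update t e i) f j ∈ compress A e ↔
      (i : ℕ) < lineCount A e (Function.update t f j) := by
  rw [Function.update_comm hef.symm, update_mem_compress]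

theorem lineCount_le [DecidableEq E] {N : ℕ} (A : Set (E → Fin N)) (e : E) (t : E → Fin N) :
    lineCount A e t ≤ N := by
  classical
  exact (Finset.card_le_univ _).trans (by simp)

theorem card_filter_val_lt {N c : ℕ} (hc : c ≤ N) :
    (Finset.univ.filter fun i : Fin N => (i : ℕ) < c).card = c := by
  rw [Fin.card_filter_val_lt, min_eq_right hc]

theorem uniformDensity_compress [Fintype E] [DecidableEq E] {N : ℕ} [NeZero N]
    (A : Set (E → Fin N)) (e : E) : uniformDensity (compress A e) = uniformDensity A := by
  classical
  rw [uniformDensity_eq_expect_line e, uniformDensity_eq_expect_line e A]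
  refine Finset.expect_congr rfl fun t _ => ?_
  rw [uniformDensity_eq_card_div, uniformDensity_eq_card_div]
  congr 2
  simp only [Set.mem_ofPred_eq, update_mem_compress]
  rw [card_filter_val_lt (lineCount_le A e t), lineCount]

theorem lineBoundary_compress_self_subset [DecidableEq E] {N : ℕ} (A : Set (E → Fin N)) (e : E) :
    lineBoundary (compress A e) e ⊆ lineBoundary A e := by
  classical
  rintro t ⟨⟨i, hi⟩, j, hj⟩
  rw [update_mem_compress] at hi hj
  constructor
  · by_contra! h
    simp [lineCount, h] at hi
  · by_contra! h
    simp only [lineCount, h, Finset.filter_true, Finset.card_univ, Fintype.card_fin] at hj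
    exact hj j.2

/-- For `f ≠ e`, work in a plane in directions `e` and `f`. After compression, the lines in
direction `e` carry nested initial segments, so the boundary count is the largest line count minus
the smallest. Before compression, the fullest line minus the emptiest already contains that many
boundary positions. -/
theorem uniformDensity_lineBoundary_compress_le [Fintype E] [DecidableEq E] {N : ℕ} [NeZero N]
    (A : Set (E → Fin N)) (e f : E) :
    uniformDensity (lineBoundary (compress A e) f) ≤ uniformDensity (lineBoundary A f) := by
  classical
  rcases eq_or_ne f e with rfl | hef
  · exact uniformDensity_mono (lineBoundary_compress_self_subset A f)
  rw [uniformDensity_eq_expect_line e, uniformDensity_eq_expect_line e (lineBoundary A f)]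
  refine Finset.expect_le_expect fun t _ => ?_
  rw [uniformDensity_eq_card_div, uniformDensity_eq_card_div]
  refine div_le_div_of_nonneg_right (Nat.cast_le.2 ?_) (Nat.cast_nonneg _)
  let c : Fin N → ℕ := fun j => lineCount A e (Function.update t f j)
  obtain ⟨jM, hM⟩ := Finite.exists_max c
  obtain ⟨jm, hm⟩ := Finite.exists_min c
  let L : Fin N → Finset (Fin N) := fun j =>
    Finset.univ.filter fun i => Function.update (Function.update t f j) e i ∈ A
  have hL : ∀ j, (L j).card = c j := fun j => by simp only [L, c, lineCount]
  let I : ℕ → Finset (Fin N) := fun m => Finset.univ.filter fun i : Fin N => (i : ℕ) < m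
  have hI : ∀ j, (I (c j)).card = c j := fun j => card_filter_val_lt (lineCount_le _ _ _)
  calc (Finset.univ.filter fun i => i ∈ {i | Function.update t e i ∈
          lineBoundary (compress A e) f}).card
      ≤ (I (c jM) \ I (c jm)).card := by
        refine Finset.card_le_card fun i hi => ?_
        simp only [Finset.mem_filter, Finset.mem_univ, true_and, Set.mem_ofPred_eq,
          lineBoundary, update_update_mem_compress hef] at hi
        obtain ⟨⟨j, hj⟩, j', hj'⟩ := hi
        simp only [I, Finset.mem_sdiff, Finset.mem_filter, Finset.mem_univ, true_and, not_lt]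
        exact ⟨hj.trans_le (hM j), (hm j').trans (not_lt.1 hj')⟩
    _ = (L jM).card - (L jm).card := by
        rw [Finset.card_sdiff_of_subset, hI, hI, hL, hL]
        intro i
        simp only [I, Finset.mem_filter, Finset.mem_univ, true_and]
        exact fun h => h.trans_le (hm jM)
    _ ≤ (L jM \ L jm).card := Finset.le_card_sdiff _ _
    _ ≤ _ := by
        refine Finset.card_le_card fun i hi => ?_
        simp only [L, Finset.mem_sdiff, Finset.mem_filter, Finset.mem_univ, true_and,
          Function.update_comm hef] at hi
        simp only [Finset.mem_filter, Finset.mem_univ, true_and, Set.mem_ofPred_eq]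
        exact ⟨⟨jM, hi.1⟩, jm, hi.2⟩

theorem lowerAlong_compress_self [DecidableEq E] {N : ℕ} (A : Set (E → Fin N)) (e : E) :
    LowerAlong (compress A e) e := by
  intro t i j hij h
  rw [update_mem_compress] at h ⊢
  exact lt_of_le_of_lt hij h

/-- Lowness along `f` nests the sections in direction `e`, so their counts decrease along `f`; this
keeps earlier compressions intact. -/
theorem LowerAlong.compress [DecidableEq E] {N : ℕ} {A : Set (E → Fin N)} {f : E}
    (hA : LowerAlong A f) (e : E) : LowerAlong (compress A e) f := by
  classical
  rcases eq_or_ne f e with rfl | hef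
  · exact lowerAlong_compress_self A f
  intro t i j hij h
  rw [← Function.update_eq_self e t, update_update_mem_compress hef] at h ⊢
  refine h.trans_le (Finset.card_le_card fun l hl => ?_)
  simp only [Finset.mem_filter, Finset.mem_univ, true_and, Function.update_comm hef] at hl ⊢
  exact hA _ _ _ hij hl

/-- Every subset of a finite grid can be replaced by a lower set of the same density whose line
boundaries are no larger. -/
theorem exists_lowerAlong [Fintype E] [DecidableEq E] {N : ℕ} [NeZero N] (A : Set (E → Fin N)) :
    ∃ A' : Set (E → Fin N), uniformDensity A' = uniformDensity A ∧
      (∀ e, uniformDensity (lineBoundary A' e) ≤ uniformDensity (lineBoundary A e)) ∧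
      ∀ e, LowerAlong A' e := by
  suffices h : ∀ S : Finset E, ∃ A' : Set (E → Fin N), uniformDensity A' = uniformDensity A ∧
      (∀ e, uniformDensity (lineBoundary A' e) ≤ uniformDensity (lineBoundary A e)) ∧
      ∀ e ∈ S, LowerAlong A' e by
    obtain ⟨A', h1, h2, h3⟩ := h Finset.univ
    exact ⟨A', h1, h2, fun e => h3 e (Finset.mem_univ e)⟩
  intro S
  induction S using Finset.induction_on with
  | empty => exact ⟨A, rfl, fun _ => le_rfl, by simp⟩
  | insert e S _ ih =>
    obtain ⟨A', h1, h2, h3⟩ := ih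
    refine ⟨compress A' e, (uniformDensity_compress A' e).trans h1,
      fun f => (uniformDensity_lineBoundary_compress_le A' e f).trans (h2 f), fun f hf => ?_⟩
    rcases Finset.mem_insert.1 hf with rfl | hf
    · exact lowerAlong_compress_self A' f
    · exact (h3 f hf).compress e

/-! ### Binary digits: from the grid to the cube. -/

theorem exists_forall_mem_iff_val_lt {M : ℕ} {S : Set (Fin M)}
    (hS : ∀ i j, i ≤ j → j ∈ S → i ∈ S) : ∃ c : ℕ, ∀ i, i ∈ S ↔ (i : ℕ) < c := by
  classical
  by_cases h : ∃ i : ℕ, ∃ hi : i < M, (⟨i, hi⟩ : Fin M) ∉ S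
  · refine ⟨Nat.find h, fun i => ⟨fun hi => ?_, fun hi => ?_⟩⟩
    · by_contra! hle
      obtain ⟨hM, hn⟩ := Nat.find_spec h
      exact hn (hS _ i hle hi)
    · by_contra hn
      exact Nat.find_min h hi ⟨i.2, hn⟩
  · push Not at h
    exact ⟨M, fun i => ⟨fun _ => i.2, fun _ => h i i.2⟩⟩

/-- Replace the binary digit of weight `2 ^ j` by `b`. -/
def setDigit {k : ℕ} (j : Fin k) (b : Fin 2) (i : Fin (2 ^ k)) : Fin (2 ^ k) :=
  finFunctionFinEquiv (Function.update (finFunctionFinEquiv.symm i) j b)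

theorem val_finFunctionFinEquiv_update {k : ℕ} (x : Fin k → Fin 2) (j : Fin k) (b : Fin 2) :
    (finFunctionFinEquiv (Function.update x j b) : ℕ) + x j * 2 ^ (j : ℕ)
      = finFunctionFinEquiv x + b * 2 ^ (j : ℕ) := by
  rw [finFunctionFinEquiv_apply, finFunctionFinEquiv_apply,
    ← Finset.add_sum_erase _ _ (Finset.mem_univ j),
    ← Finset.add_sum_erase (a := j) _ (fun i => (x i : ℕ) * 2 ^ (i : ℕ)) (Finset.mem_univ j)]
  have : ∑ i ∈ Finset.univ.erase j, ((Function.update x j b i : Fin 2) : ℕ) * 2 ^ (i : ℕ)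
      = ∑ i ∈ Finset.univ.erase j, (x i : ℕ) * 2 ^ (i : ℕ) :=
    Finset.sum_congr rfl fun i hi => by rw [Function.update_of_ne (Finset.ne_of_mem_erase hi)]
  rw [this, Function.update_self]
  ring

/-- The points of a line at which switching the digit `j` changes membership in `S`. -/
def digitBoundary {k : ℕ} (S : Set (Fin (2 ^ k))) (j : Fin k) : Set (Fin (2 ^ k)) :=
  {i | ¬ (setDigit j 0 i ∈ S ↔ setDigit j 1 i ∈ S)}

/-- The two values of the digit give points `2 ^ j` apart, one of them `i` itself. They straddle the
threshold `c` only if `i` lies within `2 ^ j` of it. -/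
theorem uniformDensity_digitBoundary_le {k : ℕ} {S : Set (Fin (2 ^ k))}
    (hS : ∀ i j, i ≤ j → j ∈ S → i ∈ S) (j : Fin k) :
    uniformDensity (digitBoundary S j) ≤ 2 * 2 ^ (j : ℕ) / 2 ^ k := by
  classical
  obtain ⟨c, hc⟩ := exists_forall_mem_iff_val_lt hS
  rw [uniformDensity_eq_card_div, Fintype.card_fin]
  push_cast
  gcongr
  have : (Finset.univ.filter (· ∈ digitBoundary S j)).card
      ≤ (Finset.Ico (c - 2 ^ (j : ℕ)) (c + 2 ^ (j : ℕ))).card := by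
    refine Finset.card_le_card_of_injOn (fun i => (i : ℕ)) (fun i hi => ?_)
      Fin.val_injective.injOn
    simp only [Finset.coe_filter, Finset.mem_univ, true_and, Set.mem_ofPred_eq, digitBoundary,
      hc, setDigit] at hi
    have h0 := val_finFunctionFinEquiv_update (finFunctionFinEquiv.symm i) j 0
    have h1 := val_finFunctionFinEquiv_update (finFunctionFinEquiv.symm i) j 1
    rw [Equiv.apply_symm_apply] at h0 h1
    have hb : ((finFunctionFinEquiv.symm i j : Fin 2) : ℕ) = 0 ∨
        ((finFunctionFinEquiv.symm i j : Fin 2) : ℕ) = 1 := by omega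
    simp only [Finset.coe_Ico, Set.mem_Ico]
    simp only [Fin.val_zero, Fin.val_one, zero_mul, one_mul, add_zero] at h0 h1
    generalize 2 ^ (j : ℕ) = w at *
    rcases hb with hb | hb <;> rw [hb] at h0 h1 <;> omega
  have h2 : (Finset.Ico (c - 2 ^ (j : ℕ)) (c + 2 ^ (j : ℕ))).card ≤ 2 * 2 ^ (j : ℕ) := by
    rw [Nat.card_Ico]; omega
  exact_mod_cast this.trans h2

/-- The influence inequality for lower sets in a dyadic grid. -/
theorem variance_mul_log_le_of_lowerAlong [Fintype E] [DecidableEq E] {k : ℕ}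
    (A : Set (E → Fin (2 ^ k))) (hA : ∀ e, LowerAlong A e) {δ : ℝ} (hδ : 0 < δ) (hδ1 : δ ≤ 1)
    (h : ∀ e, uniformDensity (lineBoundary A e) ≤ δ) :
    uniformDensity A * (1 - uniformDensity A) * Real.log (1 / δ) ≤
      8 * ∑ e, uniformDensity (lineBoundary A e) := by
  classical
  let Φ : (E × Fin k → Fin 2) ≃ (E → Fin (2 ^ k)) :=
    (Equiv.curry E (Fin k) (Fin 2)).trans (Equiv.piCongrRight fun _ => finFunctionFinEquiv)
  have hΦ : ∀ x e, Φ x e = finFunctionFinEquiv fun j => x (e, j) := fun x e => rfl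
  have hΦu : ∀ x e j b, Φ (Function.update x (e, j) b)
      = Function.update (Φ x) e (setDigit j b (Φ x e)) := by
    intro x e j b
    ext1 e'
    rcases eq_or_ne e' e with rfl | he
    · rw [Function.update_self, hΦ, setDigit, hΦ, Equiv.symm_apply_apply]
      congr 1
      ext1 j'
      rcases eq_or_ne j' j with rfl | hj
      · simp
      · simp [hj]
    · rw [Function.update_of_ne he, hΦ, hΦ]
      congr 1
      ext1 j'
      simp [he]
  let F : (E × Fin k → Fin 2) → ℝ := fun x => A.indicator (fun _ => 1) (Φ x)
  have hF : ∀ x, F x = 0 ∨ F x = 1 := fun x => by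
    by_cases hx : Φ x ∈ A <;> simp [F, hx]
  have hmean : 𝔼 x, F x = uniformDensity A := Fintype.expect_equiv Φ _ _ fun x => rfl
  have hinf : ∀ e j, 𝔼 x, |bitDeriv F (e, j) x|
      = 𝔼 t, uniformDensity (digitBoundary {i | Function.update t e i ∈ A} j) := by
    intro e j
    simp only [uniformDensity]
    have : 𝔼 x, |bitDeriv F (e, j) x| = 𝔼 t : E → Fin (2 ^ k),
        |A.indicator (fun _ => (1 : ℝ)) (Function.update t e (setDigit j 1 (t e)))
          - A.indicator (fun _ => (1 : ℝ)) (Function.update t e (setDigit j 0 (t e)))| :=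
      Fintype.expect_equiv Φ _ _ fun x => by simp only [bitDeriv, F, hΦu]
    rw [this, ← expect_expect_update e]
    refine Finset.expect_congr rfl fun t _ => Finset.expect_congr rfl fun i _ => ?_
    simp only [Function.update_self, Function.update_idem]
    by_cases h0 : Function.update t e (setDigit j 0 i) ∈ A <;>
      by_cases h1 : Function.update t e (setDigit j 1 i) ∈ A <;>
        simp [digitBoundary, h0, h1]
  have hzero : ∀ e j t, t ∉ lineBoundary A e →
      digitBoundary {i | Function.update t e i ∈ A} j = ∅ := by
    intro e j t ht
    ext i
    simp only [lineBoundary, Set.mem_ofPred_eq, not_and, not_exists, not_not] at ht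
    simp only [digitBoundary, Set.mem_ofPred_eq, Set.mem_empty_iff_false, iff_false, not_not]
    exact ⟨fun h => ht ⟨_, h⟩ _, fun h => ht ⟨_, h⟩ _⟩
  have hle : ∀ e j, 𝔼 x, |bitDeriv F (e, j) x| ≤ uniformDensity (lineBoundary A e) := by
    intro e j
    rw [hinf, uniformDensity]
    refine Finset.expect_le_expect fun t _ => ?_
    by_cases ht : t ∈ lineBoundary A e
    · rw [Set.indicator_of_mem ht]
      exact Finset.expect_le Finset.univ_nonempty fun i _ => Set.indicator_le_self' (by simp) i
    · rw [hzero e j t ht]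
      simp [uniformDensity, ht]
  have hsum : ∀ e, ∑ j, 𝔼 x, |bitDeriv F (e, j) x| ≤ 2 * uniformDensity (lineBoundary A e) := by
    intro e
    simp only [hinf]
    rw [← Finset.expect_sum_comm, uniformDensity, Finset.mul_expect]
    refine Finset.expect_le_expect fun t _ => ?_
    by_cases ht : t ∈ lineBoundary A e
    · rw [Set.indicator_of_mem ht]
      refine (Finset.sum_le_sum fun j _ =>
        -- The only use of lowness: the bounds `2 * 2 ^ j / 2 ^ k` sum to less than 2, uniformly in
        -- `k`.
        uniformDensity_digitBoundary_le (fun i i' => hA e t i i') j).trans ?_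
      rw [← Finset.sum_div, ← Finset.mul_sum, mul_div_assoc]
      gcongr
      rw [div_le_one (by positivity), Fin.sum_univ_eq_sum_range (fun j => (2 : ℝ) ^ j),
        geom_sum_eq (by norm_num)]
      norm_num
    · simp only [hzero e _ t ht]
      simp [uniformDensity, ht]
  have key := variance_mul_log_le_sum_influence F hF hδ hδ1 fun p => (hle p.1 p.2).trans (h p.1)
  rw [hmean, Fintype.sum_prod_type] at key
  have := Finset.sum_le_sum fun e (_ : e ∈ Finset.univ) => hsum e
  rw [← Finset.mul_sum] at this
  linarith

/-- The influence inequality for arbitrary subsets of a dyadic grid. -/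
theorem variance_mul_log_le_lineBoundary [Fintype E] [DecidableEq E] {k : ℕ}
    (A : Set (E → Fin (2 ^ k))) {δ : ℝ} (hδ : 0 < δ) (hδ1 : δ ≤ 1)
    (h : ∀ e, uniformDensity (lineBoundary A e) ≤ δ) :
    uniformDensity A * (1 - uniformDensity A) * Real.log (1 / δ) ≤
      8 * ∑ e, uniformDensity (lineBoundary A e) := by
  obtain ⟨A', h1, h2, h3⟩ := exists_lowerAlong A
  rw [← h1]
  refine (variance_mul_log_le_of_lowerAlong A' h3 hδ hδ1 fun e => (h2 e).trans (h e)).trans ?_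
  gcongr with e
  exact h2 e

end Grid

/-! ### Random grids of independent samples. -/

section Sampling

open MeasureTheory ProbabilityTheory

variable {Ω E : Type*} [MeasurableSpace Ω]

/-- Selecting distinct coordinates of an i.i.d. family gives an i.i.d. family. -/
theorem measurePreserving_pi_comp_injective {ι κ : Type*} [Fintype ι] [Fintype κ]
    (P : Measure Ω) [IsProbabilityMeasure P] {σ : ι → κ} (hσ : Function.Injective σ) :
    MeasurePreserving (fun (φ : κ → Ω) i => φ (σ i))
      (Measure.pi fun _ : κ => P) (Measure.pi fun _ : ι => P) := by
  refine ⟨by fun_prop, ?_⟩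
  have h : iIndepFun (fun (j : κ) (φ : κ → Ω) => φ j) (Measure.pi fun _ : κ => P) :=
    iIndepFun_pi (X := fun _ => id) fun _ => aemeasurable_id
  have h2 := h.precomp hσ
  rw [iIndepFun_iff_map_fun_eq_pi_map (fun i => (measurable_pi_apply (σ i)).aemeasurable)] at h2
  rw [h2]
  congr 1
  ext1 i
  exact (measurePreserving_eval (fun _ : κ => P) (σ i)).map_eq

/-- The configuration picked out by `t` from an array of samples. -/
def sampleAt {N : ℕ} (t : E → Fin N) (φ : E × Fin N → Ω) : E → Ω := fun e => φ (e, t e)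

theorem measurePreserving_sampleAt [Fintype E] (P : Measure Ω) [IsProbabilityMeasure P] {N : ℕ}
    (t : E → Fin N) :
    MeasurePreserving (sampleAt t) (Measure.pi fun _ : E × Fin N => P)
      (Measure.pi fun _ : E => P) :=
  measurePreserving_pi_comp_injective P (σ := fun e => (e, t e)) fun _ _ h => (Prod.ext_iff.1 h).1

theorem indepFun_sampleAt [Fintype E] (P : Measure Ω) [IsProbabilityMeasure P] {N : ℕ}
    {t t' : E → Fin N} (h : ∀ e, t e ≠ t' e) :
    IndepFun (sampleAt t) (sampleAt t') (Measure.pi fun _ : E × Fin N => P) := by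
  classical
  have hi : iIndepFun (fun (j : E × Fin N) (φ : E × Fin N → Ω) => φ j)
      (Measure.pi fun _ : E × Fin N => P) :=
    iIndepFun_pi (X := fun _ => id) fun _ => aemeasurable_id
  let S : (E → Fin N) → Finset (E × Fin N) := fun s => Finset.univ.image fun e => (e, s e)
  have hS : ∀ s e, (e, s e) ∈ S s := fun s e => Finset.mem_image_of_mem _ (Finset.mem_univ e)
  have hd : Disjoint (S t) (S t') := by
    rw [Finset.disjoint_left]
    intro x hx hx'
    simp only [S, Finset.mem_image, Finset.mem_univ, true_and] at hx hx'
    obtain ⟨e, rfl⟩ := hx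
    obtain ⟨e', he'⟩ := hx'
    obtain ⟨rfl, h2⟩ := Prod.ext_iff.1 he'
    exact h _ h2.symm
  have := hi.indepFun_finset (S t) (S t') hd fun j => measurable_pi_apply j
  exact this.comp (φ := fun x e => x ⟨(e, t e), hS t e⟩) (ψ := fun x e => x ⟨(e, t' e), hS t' e⟩)
    (by fun_prop) (by fun_prop)

/-- The proportion of sampled configurations that lie in `B`. -/
noncomputable def empiricalDensity [Fintype E] [DecidableEq E] {N : ℕ} (B : Set (E → Ω))
    (φ : E × Fin N → Ω) : ℝ :=
  uniformDensity {t : E → Fin N | sampleAt t φ ∈ B}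

theorem uniformDensity_exists_eq_le [Fintype E] [DecidableEq E] {N : ℕ} [NeZero N] (t : E → Fin N) :
    uniformDensity {t' : E → Fin N | ∃ e, t e = t' e} ≤ Fintype.card E / N := by
  classical
  have h1 : ∀ e, uniformDensity {t' : E → Fin N | t e = t' e} = 1 / N := by
    intro e
    rw [uniformDensity_eq_expect_line e]
    simp only [Set.mem_ofPred_eq, Function.update_self]
    rw [Fintype.expect_const, uniformDensity_eq_card_div]
    simp [Finset.filter_eq']
  calc uniformDensity {t' : E → Fin N | ∃ e, t e = t' e}
      ≤ ∑ e, uniformDensity {t' : E → Fin N | t e = t' e} := by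
        simp only [uniformDensity]
        rw [← Finset.expect_sum_comm]
        refine Finset.expect_le_expect fun t' _ => ?_
        by_cases h : ∃ e, t e = t' e
        · obtain ⟨e, he⟩ := h
          rw [Set.indicator_of_mem (show t' ∈ {t' | ∃ e, t e = t' e} from ⟨e, he⟩)]
          refine le_trans ?_ (Finset.single_le_sum (f := fun e =>
            Set.indicator {t' : E → Fin N | t e = t' e} (fun _ => (1 : ℝ)) t')
            (fun i _ => Set.indicator_nonneg (fun _ _ => zero_le_one) _) (Finset.mem_univ e))
          simp [he]
        · rw [Set.indicator_of_notMem (show t' ∉ {t' | ∃ e, t e = t' e} from h)]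
          exact Finset.sum_nonneg fun i _ => Set.indicator_nonneg (fun _ _ => zero_le_one) _
    _ = Fintype.card E / N := by
        simp only [h1, Finset.sum_const, Finset.card_univ, nsmul_eq_mul]
        ring

theorem integral_expect {X ι : Type*} [MeasurableSpace X] [Fintype ι] {μ : Measure X}
    {f : ι → X → ℝ} (hf : ∀ i, Integrable (f i) μ) :
    ∫ x, 𝔼 i, f i x ∂μ = 𝔼 i, ∫ x, f i x ∂μ := by
  simp only [Fintype.expect_eq_sum_div_card]
  rw [integral_div, integral_finsetSum _ fun i _ => hf i]

theorem measurable_sampleAt {N : ℕ} (t : E → Fin N) :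
    Measurable (sampleAt (Ω := Ω) t) := by
  unfold sampleAt
  fun_prop

theorem measurable_empiricalDensity [Fintype E] [DecidableEq E] {N : ℕ} {B : Set (E → Ω)}
    (hB : MeasurableSet B) : Measurable (empiricalDensity (N := N) B) := by
  unfold empiricalDensity uniformDensity
  simp only [Fintype.expect_eq_sum_div_card]
  refine (Finset.measurable_sum _ fun t _ => ?_).div_const _
  exact (measurable_const.indicator hB).comp (measurable_sampleAt t)

theorem integrable_sq_empiricalDensity_sub [Fintype E] [DecidableEq E] (P : Measure Ω)
    [IsProbabilityMeasure P] {N : ℕ} [NeZero N] {B : Set (E → Ω)} (hB : MeasurableSet B) :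
    Integrable (fun φ : E × Fin N → Ω =>
      (empiricalDensity B φ - (Measure.pi fun _ : E => P).real B) ^ 2)
      (Measure.pi fun _ : E × Fin N => P) := by
  refine Integrable.of_bound
    (((measurable_empiricalDensity hB).sub_const _).pow_const 2).aestronglyMeasurable 1
    (Filter.Eventually.of_forall fun φ => ?_)
  have h0 : 0 ≤ empiricalDensity B φ := uniformDensity_nonneg _
  have h1 : empiricalDensity B φ ≤ 1 :=
    Finset.expect_le Finset.univ_nonempty fun i _ => Set.indicator_le_self' (by simp) i
  have h2 : 0 ≤ (Measure.pi fun _ : E => P).real B := measureReal_nonneg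
  have h3 : (Measure.pi fun _ : E => P).real B ≤ 1 := measureReal_le_one
  rw [Real.norm_eq_abs, abs_of_nonneg (sq_nonneg _)]
  nlinarith

/-- The variance of the empirical density is at most `|E| / N`. -/
theorem integral_sq_empiricalDensity_sub_le [Fintype E] [DecidableEq E] (P : Measure Ω)
    [IsProbabilityMeasure P] {N : ℕ} [NeZero N] {B : Set (E → Ω)} (hB : MeasurableSet B) :
    ∫ φ : E × Fin N → Ω, (empiricalDensity B φ - (Measure.pi fun _ : E => P).real B) ^ 2
      ∂(Measure.pi fun _ : E × Fin N => P) ≤ Fintype.card E / N := by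
  set Q := Measure.pi fun _ : E × Fin N => P
  set p := (Measure.pi fun _ : E => P).real B with hp
  have hp0 : 0 ≤ p := measureReal_nonneg
  have hp1 : p ≤ 1 := measureReal_le_one
  let y : (E → Ω) → ℝ := fun ω => B.indicator (fun _ => (1 : ℝ)) ω - p
  have hy : Measurable y := (measurable_const.indicator hB).sub_const _
  have hyb : ∀ ω, |y ω| ≤ 1 := by
    intro ω
    by_cases h : ω ∈ B <;> simp [y, h, abs_le] <;> constructor <;> linarith
  have hymean : ∫ ω, y ω ∂(Measure.pi fun _ : E => P) = 0 := by
    simp only [y]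
    rw [integral_sub ((integrable_const _).indicator hB) (integrable_const _),
      integral_indicator_const _ hB]
    simp [hp]
  have hyt : ∀ t : E → Fin N, ∫ φ, y (sampleAt t φ) ∂Q = 0 := by
    intro t
    rw [← hymean, ← (measurePreserving_sampleAt P t).map_eq,
      integral_map (measurable_sampleAt t).aemeasurable hy.aestronglyMeasurable]
  have hbd : ∀ t t' φ, |y (sampleAt t φ) * y (sampleAt (N := N) t' φ)| ≤ 1 := by
    intro t t' φ
    rw [abs_mul]
    exact mul_le_one₀ (hyb _) (abs_nonneg _) (hyb _)
  have hint : ∀ t t' : E → Fin N, Integrable (fun φ => y (sampleAt t φ) * y (sampleAt t' φ)) Q :=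
    fun t t' => Integrable.of_bound
      ((hy.comp (measurable_sampleAt t)).mul (hy.comp (measurable_sampleAt t'))).aestronglyMeasurable
      1 (Filter.Eventually.of_forall fun φ => hbd t t' φ)
  have hsq : ∀ φ : E × Fin N → Ω, (empiricalDensity B φ - p) ^ 2
      = 𝔼 t : E → Fin N, 𝔼 t' : E → Fin N, y (sampleAt t φ) * y (sampleAt t' φ) := by
    intro φ
    have : empiricalDensity B φ - p = 𝔼 t : E → Fin N, y (sampleAt t φ) := by
      simp only [y]
      rw [Finset.expect_sub_distrib, Fintype.expect_const]
      rfl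
    rw [this, sq, Finset.expect_mul_expect]
  simp only [hsq]
  rw [integral_expect fun t => by
    simp only [Fintype.expect_eq_sum_div_card]
    exact (integrable_finsetSum _ fun t' _ => hint t t').div_const _]
  refine Finset.expect_le Finset.univ_nonempty fun t _ => ?_
  rw [integral_expect fun t' => hint t t']
  refine le_trans ?_ (uniformDensity_exists_eq_le t)
  refine Finset.expect_le_expect fun t' _ => ?_
  -- Index pairs sharing no sample have zero covariance; the others contribute at most 1 each and
  -- are rare.
  by_cases h : ∃ e, t e = t' e
  · rw [Set.indicator_of_mem (show t' ∈ {t' | ∃ e, t e = t' e} from h)]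
    refine (integral_mono (hint t t') (integrable_const 1) fun φ =>
      (le_abs_self _).trans (hbd t t' φ)).trans ?_
    simp
  · rw [Set.indicator_of_notMem (show t' ∉ {t' | ∃ e, t e = t' e} from h)]
    push Not at h
    have := (indepFun_sampleAt P h).integral_fun_comp_mul_comp (f := y) (g := y)
      (measurable_sampleAt t).aemeasurable (measurable_sampleAt t').aemeasurable
      hy.aestronglyMeasurable hy.aestronglyMeasurable
    rw [this, hyt, zero_mul]

end Sampling

/-! ### Fibres, influences and the transfer from grids to product spaces. -/

section Influence

open MeasureTheory ProbabilityTheory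

variable {Ω E : Type*} [MeasurableSpace Ω] [DecidableEq E]

theorem measurable_extendAt (e : E) :
    Measurable fun p : ({f : E // f ≠ e} → Ω) × Ω => extendAt e p.1 p.2 := by
  refine measurable_pi_lambda _ fun f => ?_
  by_cases h : f = e
  · simp only [extendAt, h, dite_true]
    exact measurable_snd
  · simp only [extendAt, h, dite_false]
    fun_prop

theorem measurableSet_fibreSection {A : Set (E → Ω)} (hA : MeasurableSet A) (e : E)
    (ψ : {f : E // f ≠ e} → Ω) : MeasurableSet (fibreSection A e ψ) :=
  (measurable_extendAt e).comp measurable_prodMk_left hA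

theorem measurable_measure_fibreSection (P : Measure Ω) [IsProbabilityMeasure P]
    {A : Set (E → Ω)} (hA : MeasurableSet A) (e : E) :
    Measurable fun ψ => P (fibreSection A e ψ) :=
  measurable_measure_prodMk_left (measurable_extendAt e hA)

/-- The configurations whose fibre in the direction `e` is not almost surely constant. -/
def fibreBoundary (P : Measure Ω) (A : Set (E → Ω)) (e : E) : Set (E → Ω) :=
  {ω | 0 < P (fibreSection A e fun f => ω f) ∧ P (fibreSection A e fun f => ω f) < 1}

theorem measurableSet_nonconstant_fibre (P : Measure Ω) [IsProbabilityMeasure P]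
    {A : Set (E → Ω)} (hA : MeasurableSet A) (e : E) :
    MeasurableSet {ψ | 0 < P (fibreSection A e ψ) ∧ P (fibreSection A e ψ) < 1} :=
  (measurableSet_lt measurable_const (measurable_measure_fibreSection P hA e)).inter
    (measurableSet_lt (measurable_measure_fibreSection P hA e) measurable_const)

theorem measurableSet_fibreBoundary (P : Measure Ω) [IsProbabilityMeasure P]
    {A : Set (E → Ω)} (hA : MeasurableSet A) (e : E) : MeasurableSet (fibreBoundary P A e) :=
  (show Measurable fun (ω : E → Ω) (f : {f : E // f ≠ e}) => ω f by fun_prop)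
    (measurableSet_nonconstant_fibre P hA e)

variable [Fintype E]

theorem measurePreserving_extendAt (P : Measure Ω) [IsProbabilityMeasure P] (e : E) :
    MeasurePreserving (fun p : ({f : E // f ≠ e} → Ω) × Ω => extendAt e p.1 p.2)
      ((Measure.pi fun _ : {f : E // f ≠ e} => P).prod P) (Measure.pi fun _ : E => P) := by
  refine ⟨measurable_extendAt e, (Measure.pi_eq fun s hs => ?_).symm⟩
  rw [Measure.map_apply (measurable_extendAt e) (MeasurableSet.univ_pi hs)]
  have : (fun p : ({f : E // f ≠ e} → Ω) × Ω => extendAt e p.1 p.2) ⁻¹' Set.pi Set.univ s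
      = (Set.pi Set.univ fun f : {f : E // f ≠ e} => s f) ×ˢ s e := by
    ext ⟨ψ, x⟩
    simp only [Set.mem_preimage, Set.mem_pi, Set.mem_univ, true_implies, Set.mem_prod]
    constructor
    · intro h
      exact ⟨fun f => by simpa [extendAt, f.2] using h f, by simpa [extendAt] using h e⟩
    · rintro ⟨h1, h2⟩ f
      by_cases hf : f = e
      · subst hf
        simpa [extendAt] using h2
      · simpa [extendAt, hf] using h1 ⟨f, hf⟩
  rw [this, Measure.prod_prod, Measure.pi_pi, mul_comm,
    ← Fintype.prod_eq_mul_prod_subtype_ne (fun i => P (s i)) e]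

/-- Viewing the influence as the probability of an event in the full product lets the sampling
estimate apply to it as it does to `A`. -/
theorem measureReal_fibreBoundary (P : Measure Ω) [IsProbabilityMeasure P]
    {A : Set (E → Ω)} (hA : MeasurableSet A) (e : E) :
    (Measure.pi fun _ : E => P).real (fibreBoundary P A e) = influence P A e := by
  have := (measurePreserving_pi_comp_injective P
    (σ := fun f : {f : E // f ≠ e} => (f : E)) Subtype.val_injective).measure_preimage
    (measurableSet_nonconstant_fibre P hA e).nullMeasurableSet
  rw [influence, measureReal_def, measureReal_def, ← this]
  rfl

/-- Almost surely, membership in `A` agrees with an almost surely constant fibre. -/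
theorem ae_mem_of_fibre_constant (P : Measure Ω) [IsProbabilityMeasure P]
    {A : Set (E → Ω)} (hA : MeasurableSet A) (e : E) :
    ∀ᵐ ω ∂(Measure.pi fun _ : E => P),
      (P (fibreSection A e fun f => ω f) = 0 → ω ∉ A) ∧
      (P (fibreSection A e fun f => ω f) = 1 → ω ∈ A) := by
  have hr : Measurable fun ω : E → Ω => P (fibreSection A e fun f => ω f) :=
    (measurable_measure_fibreSection P hA e).comp
      (show Measurable fun (ω : E → Ω) (f : {f : E // f ≠ e}) => ω f by fun_prop)
  have hm : MeasurableSet {ω : E → Ω | (P (fibreSection A e fun f => ω f) = 0 → ω ∉ A) ∧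
      (P (fibreSection A e fun f => ω f) = 1 → ω ∈ A)} := by
    have h0 : MeasurableSet {ω : E → Ω | P (fibreSection A e fun f => ω f) = 0} :=
      hr (measurableSet_singleton 0)
    have h1 : MeasurableSet {ω : E → Ω | P (fibreSection A e fun f => ω f) = 1} :=
      hr (measurableSet_singleton 1)
    exact (h0.imp hA.compl).inter (h1.imp hA)
  rw [← (measurePreserving_extendAt P e).map_eq,
    ae_map_iff (measurable_extendAt e).aemeasurable hm]
  have hm' := measurable_extendAt e hm
  refine (Measure.ae_prod_iff_ae_ae hm').2 (Filter.Eventually.of_forall fun ψ => ?_)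
  have hψ : ∀ x : Ω, (fun f : {f : E // f ≠ e} => extendAt e ψ x f) = ψ := by
    intro x
    ext1 f
    simp [extendAt, f.2]
  simp only [Set.mem_ofPred_eq, hψ]
  have h0 : P (fibreSection A e ψ) = 0 → ∀ᵐ x ∂P, extendAt e ψ x ∉ A := fun h =>
    measure_eq_zero_iff_ae_notMem.1 h
  have h1 : P (fibreSection A e ψ) = 1 → ∀ᵐ x ∂P, extendAt e ψ x ∈ A := fun h =>
    (mem_ae_iff_prob_eq_one (measurableSet_fibreSection hA e ψ)).2 h
  rw [Filter.eventually_and, Filter.eventually_imp_distrib_left,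
    Filter.eventually_imp_distrib_left]
  exact ⟨h0, h1⟩

/-- A large array of samples reproduces the density of `A` and its influences. -/
theorem exists_grid_approximation (P : Measure Ω) [IsProbabilityMeasure P]
    {A : Set (E → Ω)} (hA : MeasurableSet A) {ε : ℝ} (hε : 0 < ε) :
    ∃ (k : ℕ) (A' : Set (E → Fin (2 ^ k))),
      |uniformDensity A' - (Measure.pi fun _ : E => P).real A| ≤ ε ∧
      ∀ e, uniformDensity (lineBoundary A' e) ≤ influence P A e + ε := by
  set n : ℝ := (Fintype.card E : ℝ) with hn
  -- There are `1 + n` empirical densities to control, each of variance at most `n / 2 ^ k`.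
  obtain ⟨k, hk⟩ := pow_unbounded_of_one_lt ((1 + n) * n / ε ^ 2) one_lt_two
  set Q := Measure.pi fun _ : E × Fin (2 ^ k) => P with hQ
  have hae : ∀ᵐ φ ∂Q, ∀ (e : E) (t : E → Fin (2 ^ k)),
      (P (fibreSection A e fun f => sampleAt t φ f) = 0 → sampleAt t φ ∉ A) ∧
      (P (fibreSection A e fun f => sampleAt t φ f) = 1 → sampleAt t φ ∈ A) := by
    rw [ae_all_iff]
    intro e
    rw [ae_all_iff]
    intro t
    exact (measurePreserving_sampleAt P t).quasiMeasurePreserving.ae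
      (ae_mem_of_fibre_constant P hA e)
  let p : Set (E → Ω) → ℝ := fun B => (Measure.pi fun _ : E => P).real B
  -- One total squared error: a sample outside the null set with `F` at most its mean controls every
  -- density at once.
  let F : (E × Fin (2 ^ k) → Ω) → ℝ := fun φ => (empiricalDensity A φ - p A) ^ 2 +
    ∑ e, (empiricalDensity (fibreBoundary P A e) φ - p (fibreBoundary P A e)) ^ 2
  have hi1 : Integrable (fun φ => (empiricalDensity A φ - p A) ^ 2) Q :=
    integrable_sq_empiricalDensity_sub P hA
  have hi2 : ∀ e, Integrable (fun φ =>
      (empiricalDensity (fibreBoundary P A e) φ - p (fibreBoundary P A e)) ^ 2) Q := fun e =>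
    integrable_sq_empiricalDensity_sub P (measurableSet_fibreBoundary P hA e)
  have hi3 := integrable_finsetSum Finset.univ fun e _ => hi2 e
  have hF : Integrable F Q := hi1.add hi3
  have hFint : ∫ φ, F φ ∂Q ≤ ε ^ 2 := by
    simp only [F]
    rw [integral_add hi1 hi3, integral_finsetSum _ fun e _ => hi2 e]
    have h1 := integral_sq_empiricalDensity_sub_le (N := 2 ^ k) P hA
    have h2 := Finset.sum_le_sum fun e (_ : e ∈ Finset.univ) =>
      integral_sq_empiricalDensity_sub_le (N := 2 ^ k) P (measurableSet_fibreBoundary P hA e)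
    rw [Finset.sum_const, Finset.card_univ, nsmul_eq_mul] at h2
    refine (add_le_add h1 h2).trans ?_
    rw [div_lt_iff₀ (by positivity)] at hk
    push_cast
    rw [← hn, ← one_add_mul, ← mul_div_assoc, div_le_iff₀ (by positivity)]
    linarith
  obtain ⟨φ, hφ, hφF⟩ := exists_notMem_null_le_integral hF hae
  rw [Set.mem_compl_iff, not_not] at hφ
  have hFle : F φ ≤ ε ^ 2 := hφF.trans hFint
  have hsnn : 0 ≤ ∑ e, (empiricalDensity (fibreBoundary P A e) φ
      - p (fibreBoundary P A e)) ^ 2 := Finset.sum_nonneg fun _ _ => sq_nonneg _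
  refine ⟨k, {t | sampleAt t φ ∈ A}, ?_, fun e => ?_⟩
  · refine abs_le_of_sq_le_sq ?_ hε.le
    have : (empiricalDensity A φ - p A) ^ 2 ≤ F φ := le_add_of_nonneg_right hsnn
    exact this.trans hFle
  · have hsub : lineBoundary {t | sampleAt t φ ∈ A} e
        ⊆ {t | sampleAt t φ ∈ fibreBoundary P A e} := by
      rintro t ⟨⟨i, hi⟩, j, hj⟩
      have hoff : ∀ l, (fun f : {f : E // f ≠ e} => sampleAt (Function.update t e l) φ f)
          = fun f : {f : E // f ≠ e} => sampleAt t φ f := by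
        intro l
        ext1 f
        simp [sampleAt, f.2]
      have hi' := (hφ e (Function.update t e i)).1
      have hj' := (hφ e (Function.update t e j)).2
      rw [hoff] at hi' hj'
      refine ⟨pos_iff_ne_zero.2 fun h => hi' h hi, lt_of_le_of_ne prob_le_one fun h => hj (hj' h)⟩
    refine (uniformDensity_mono hsub).trans ?_
    have h1 : (empiricalDensity (fibreBoundary P A e) φ - p (fibreBoundary P A e)) ^ 2 ≤ F φ :=
      (Finset.single_le_sum (f := fun e => (empiricalDensity (fibreBoundary P A e) φ
        - p (fibreBoundary P A e)) ^ 2) (fun _ _ => sq_nonneg _) (Finset.mem_univ e)).trans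
        (le_add_of_nonneg_left (sq_nonneg _))
    have h2 := (abs_le.1 (abs_le_of_sq_le_sq (h1.trans hFle) hε.le)).2
    have h3 : p (fibreBoundary P A e) = influence P A e := measureReal_fibreBoundary P hA e
    have h4 : empiricalDensity (fibreBoundary P A e) φ
      = uniformDensity {t | sampleAt t φ ∈ fibreBoundary P A e} := rfl
    linarith

/-- The influence inequality with a strict upper bound `δ` for the influences. -/
theorem variance_mul_log_le_influence (P : Measure Ω) [IsProbabilityMeasure P]
    {A : Set (E → Ω)} (hA : MeasurableSet A) {δ : ℝ} (hδ : 0 < δ) (hδ1 : δ ≤ 1)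
    (h : ∀ e, influence P A e < δ) :
    (Measure.pi fun _ : E => P).real A * (1 - (Measure.pi fun _ : E => P).real A) *
      Real.log (1 / δ) ≤ 8 * ∑ e, influence P A e := by
  set p := (Measure.pi fun _ : E => P).real A with hp
  have hp0 : 0 ≤ p := measureReal_nonneg
  have hp1 : p ≤ 1 := measureReal_le_one
  have hL : 0 ≤ Real.log (1 / δ) := Real.log_nonneg (by rw [le_div_iff₀ hδ]; linarith)
  obtain ⟨ε₀, hε₀, hlt⟩ : ∃ ε₀ : ℝ, 0 < ε₀ ∧ ∀ e, influence P A e + ε₀ ≤ δ := by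
    rcases isEmpty_or_nonempty E with hE | hE
    · exact ⟨1, one_pos, fun e => isEmptyElim e⟩
    · obtain ⟨e₀, he₀⟩ := Finite.exists_max (influence P A)
      exact ⟨δ - influence P A e₀, sub_pos.2 (h e₀), fun e => by linarith [he₀ e]⟩
  refine le_of_forall_pos_le_add fun η hη => ?_
  -- The error budget per unit of `ε`: the logarithm from perturbing the variance, `8 * |E|` from
  -- the influences, and 1 for positivity.
  set c : ℝ := Real.log (1 / δ) + 8 * Fintype.card E + 1 with hc
  have hcpos : 0 < c := by positivity
  set ε := min ε₀ (η / c) with hεdef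
  have hε : 0 < ε := lt_min hε₀ (div_pos hη hcpos)
  have hεc : ε * c ≤ η := (le_div_iff₀ hcpos).1 (min_le_right _ _)
  obtain ⟨k, A', h1, h2⟩ := exists_grid_approximation P hA hε
  have key := variance_mul_log_le_lineBoundary A' hδ hδ1 fun e =>
    (h2 e).trans ((add_le_add_right (min_le_left _ _) _).trans (hlt e))
  have hsum := Finset.sum_le_sum fun e (_ : e ∈ Finset.univ) => h2 e
  rw [Finset.sum_add_distrib, Finset.sum_const, Finset.card_univ, nsmul_eq_mul] at hsum
  set q := uniformDensity A'
  have hq0 : 0 ≤ q := uniformDensity_nonneg _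
  have hq1 : q ≤ 1 :=
    Finset.expect_le Finset.univ_nonempty fun i _ => Set.indicator_le_self' (by simp) i
  have hvar : p * (1 - p) ≤ q * (1 - q) + ε := by
    have e1 : p * (1 - p) - q * (1 - q) = (q - p) * (q + p - 1) := by ring
    have e2 : (q - p) * (q + p - 1) ≤ |q - p| * |q + p - 1| := by
      rw [← abs_mul]; exact le_abs_self _
    have e3 : |q + p - 1| ≤ 1 := abs_le.2 ⟨by linarith, by linarith⟩
    have e4 := mul_le_of_le_one_right (abs_nonneg (q - p)) e3
    linarith
  have := mul_le_mul_of_nonneg_right hvar hL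
  rw [hc] at hεc
  nlinarith

end Influence

/-! ### Deduction of both bounds from the influence inequality. -/

theorem theorem1 :
    ∃ c c' : ℝ, 0 < c ∧ 0 < c' ∧
      ∀ (Ω : Type*) [MeasurableSpace Ω] (P : MeasureTheory.Measure Ω)
        [MeasureTheory.IsProbabilityMeasure P]
        (E : Type*) [Fintype E] [DecidableEq E] (A : Set (E → Ω)),
        MeasurableSet A →
        0 < (MeasureTheory.Measure.pi (fun _ : E => P)).real A →
        (MeasureTheory.Measure.pi (fun _ : E => P)).real A < 1 →
        (∃ m : ℝ, IsGreatest (Set.range (influence P A)) m ∧ 0 < m ∧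
          c * ((MeasureTheory.Measure.pi (fun _ : E => P)).real A *
              (1 - (MeasureTheory.Measure.pi (fun _ : E => P)).real A)) *
              Real.log (1 / (2 * m))
            ≤ ∑ e : E, influence P A e) ∧
        (∃ e : E,
          c' * ((MeasureTheory.Measure.pi (fun _ : E => P)).real A *
              (1 - (MeasureTheory.Measure.pi (fun _ : E => P)).real A)) *
              (Real.log (Fintype.card E) / Fintype.card E)
            ≤ influence P A e) := by
  -- The second constant is half the first because only `log (1 / (2 * m)) ≥ log n / 2` is
  -- available.
  refine ⟨1 / 8, 1 / 16, by norm_num, by norm_num, ?_⟩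
  intro Ω _ P _ E _ _ A hA hpos hlt
  have hbound := fun δ => variance_mul_log_le_influence P hA (δ := δ)
  set p := (MeasureTheory.Measure.pi (fun _ : E => P)).real A with hp
  have hV : 0 < p * (1 - p) := mul_pos hpos (sub_pos.2 hlt)
  have hlog2 : 0 < Real.log (1 / (1 / 2)) := Real.log_pos (by norm_num)
  have hE : Nonempty E := by
    by_contra h
    rw [not_nonempty_iff] at h
    have := hbound (1 / 2) (by norm_num) (by norm_num) fun e => isEmptyElim e
    rw [Finset.univ_eq_empty, Finset.sum_empty, mul_zero] at this
    exact absurd this (not_le.2 (mul_pos hV hlog2))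
  obtain ⟨e₀, he₀⟩ := Finite.exists_max (influence P A)
  set m := influence P A e₀ with hm
  have hI0 : ∀ e, 0 ≤ influence P A e := fun e => MeasureTheory.measureReal_nonneg
  have hm0 : 0 < m := by
    refine lt_of_le_of_ne (hI0 e₀) fun h0 => ?_
    have hz : ∀ e, influence P A e = 0 := fun e => le_antisymm (h0 ▸ he₀ e) (hI0 e)
    -- If all influences vanished, `δ = 1 / 2` would make a positive quantity at most 0.
    have := hbound (1 / 2) (by norm_num) (by norm_num) fun e => by rw [hz]; norm_num
    simp only [hz, Finset.sum_const_zero, mul_zero] at this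
    exact absurd this (not_le.2 (mul_pos hV hlog2))
  have hmain : 1 / 8 * (p * (1 - p)) * Real.log (1 / (2 * m)) ≤ ∑ e : E, influence P A e := by
    -- Taking `δ = 2 * m` makes the bound on the influences strict since `m > 0`. If `2 * m > 1`,
    -- the logarithm is negative and the claim is trivial.
    rcases le_or_gt (2 * m) 1 with h | h
    · have := hbound (2 * m) (by positivity) h fun e => by linarith [he₀ e]
      linarith
    · refine le_trans ?_ (Finset.sum_nonneg fun e _ => hI0 e)
      refine mul_nonpos_of_nonneg_of_nonpos (by positivity) (Real.log_nonpos (by positivity) ?_)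
      rw [div_le_one (by positivity)]
      exact h.le
  refine ⟨⟨m, ⟨⟨e₀, rfl⟩, by rintro _ ⟨e, rfl⟩; exact he₀ e⟩, hm0, hmain⟩, e₀, ?_⟩
  set n : ℝ := (Fintype.card E : ℝ) with hn
  have hn1 : 1 ≤ n := by
    rw [hn]
    exact_mod_cast (Fintype.card_pos : 0 < Fintype.card E)
  have hn0 : 0 < n := by linarith
  have hlogn : 0 ≤ Real.log n := Real.log_nonneg hn1
  by_contra! hcon
  have hsum : ∑ e : E, influence P A e ≤ n * m := by
    refine (Finset.sum_le_card_nsmul _ _ m fun e _ => he₀ e).trans ?_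
    rw [Finset.card_univ, nsmul_eq_mul]
  have hsn : 0 < √n := Real.sqrt_pos.2 hn0
  have hlogsq : Real.log n ≤ 2 * √n := by
    have := Real.log_le_sub_one_of_pos hsn
    rw [Real.log_sqrt hn0.le] at this
    linarith
  have hV1 : p * (1 - p) ≤ 1 := by nlinarith
  -- The assumed failure makes `m` so small that the first bound forces `n * m` back up to the
  -- excluded size.
  have h2m : 2 * m ≤ 1 / √n := by
    have h1 : Real.log n / n ≤ 2 / √n := by
      rw [div_le_div_iff₀ hn0 hsn]
      have := Real.mul_self_sqrt hn0.le
      nlinarith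
    have h2 : p * (1 - p) * (Real.log n / n) ≤ 2 / √n :=
      (mul_le_of_le_one_left (by positivity) hV1).trans h1
    have h3 : 2 / √n = 2 * (1 / √n) := by ring
    have h4 : 0 < 1 / √n := by positivity
    linarith
  have hlog : Real.log n / 2 ≤ Real.log (1 / (2 * m)) := by
    rw [← Real.log_sqrt hn0.le]
    refine Real.log_le_log hsn ?_
    rw [le_div_iff₀ (by positivity), mul_comm]
    exact (le_div_iff₀ hsn).1 h2m
  have hfin : 1 / 16 * (p * (1 - p)) * Real.log n ≤ n * m := by
    have := mul_le_mul_of_nonneg_left hlog (show 0 ≤ 1 / 8 * (p * (1 - p)) by positivity)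
    linarith
  rw [← mul_div_assoc, lt_div_iff₀ hn0] at hcon
  linarith
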